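/- Consider the partial differential equation $$u_t+(u_x+u_{xx})^2=0$$ for a real function $u=u(t,x)$, and put $\Delta=u_t+(u_x+u_{xx})^2$, a function on the second jet space with coordinates $(t,x,u,u_t,u_x,u_{tt},u_{tx},u_{xx})$. Let $U\subseteq\mathbb{R}^3$ be a non-empty connected open set of points $(t,x,u)$ (for example $U=\mathbb{R}^3$). A smooth vector field $V=\tau\,\partial_t+\xi\,\partial_x+\eta\,\partial_u$ on $U$, with coefficients depending on $(t,x,u)$, is an infinitesimal Lie point symmetry of the equation over $U$ if its second prolongation $\mathrm{pr}^{(2)}V$ satisfies $\mathrm{pr}^{(2)}V(\Delta)=0$ at every point of the second jet space that lies over $U$ and at which $\Delta=0$. Then the set $A$ of all infinitesimal Lie point symmetries of the equation over $U$ (its maximal algebra of invariance) is a real Lie algebra under the commutator of vector fields. It is five-dimensional, and the (restrictions to $U$ of the) vector fields $$X_1=-\partial_x,\quad X_2=-e^{-x}\partial_u,\quad X_3=\partial_t,\quad X_4=\partial_u,\quad X_5=t\,\partial_t-u\,\partial_u$$ form a basis of it. The non-zero commutators $[X_i,X_j]$ with $i<j$ are $$[X_1,X_2]=X_2,\quad[X_2,X_5]=-X_2,\quad[X_3,X_5]=X_3,\quad[X_4,X_5]=-X_4,$$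 and all the others with $i<j$ vanish. Moreover, $A$ is the semidirect sum of its one-dimensional subalgebra spanned by $X_5$ and its four-dimensional ideal spanned by $X_1,X_2,X_3,X_4$, and this ideal is isomorphic, as a Lie algebra, to $A_2\oplus 2A_1=A_2\oplus A_1\oplus A_1$, where $A_1$ is the one-dimensional Lie algebra and $A_2$ is the two-dimensional Lie algebra with basis $e_1,e_2$ and $[e_1,e_2]=e_2$. -/

import Mathlib

open scoped ContDiff

noncomputable section

namespace PointSymmetry

/-! ### Jets -/

/-- The space of the variables `(t, x, u)`. -/
abbrev Base : Type := ℝ × ℝ × ℝ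

/-- The first jet space, with coordinates `((t, x, u), (u_t, u_x))`. -/
abbrev Jet1 : Type := Base × (ℝ × ℝ)

/-- The second jet space, with coordinates `(((t, x, u), (u_t, u_x)), (u_tt, u_tx, u_xx))`. -/
abbrev Jet2 : Type := Jet1 × (ℝ × ℝ × ℝ)

/-- The coordinate `u_t` on the first jet space. -/
def Jet1.ut (j : Jet1) : ℝ := j.2.1

/-- The coordinate `u_x` on the first jet space. -/
def Jet1.ux (j : Jet1) : ℝ := j.2.2

/-- The coordinate `u_tt` on the second jet space. -/
def Jet2.utt (j : Jet2) : ℝ := j.2.1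

/-- The coordinate `u_tx` on the second jet space. -/
def Jet2.utx (j : Jet2) : ℝ := j.2.2.1

/-- The coordinate `u_xx` on the second jet space. -/
def Jet2.uxx (j : Jet2) : ℝ := j.2.2.2

/-- The total derivative `D_t f = f_t + u_t f_u` of a function of `(t, x, u)`. -/
def totalDt (f : Base → ℝ) (j : Jet1) : ℝ :=
  fderiv ℝ f j.1 (1, 0, Jet1.ut j)

/-- The total derivative `D_x f = f_x + u_x f_u` of a function of `(t, x, u)`. -/
def totalDx (f : Base → ℝ) (j : Jet1) : ℝ :=
  fderiv ℝ f j.1 (0, 1, Jet1.ux j)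

/-- The total derivative `D_t g = g_t + u_t g_u + u_tt g_{u_t} + u_tx g_{u_x}` of a function on the
first jet space. -/
def totalDt₁ (g : Jet1 → ℝ) (j : Jet2) : ℝ :=
  fderiv ℝ g j.1 ((1, 0, Jet1.ut j.1), (Jet2.utt j, Jet2.utx j))

/-- The total derivative `D_x g = g_x + u_x g_u + u_tx g_{u_t} + u_xx g_{u_x}` of a function on the
first jet space. -/
def totalDx₁ (g : Jet1 → ℝ) (j : Jet2) : ℝ :=
  fderiv ℝ g j.1 ((0, 1, Jet1.ux j.1), (Jet2.utx j, Jet2.uxx j))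

/-! ### Prolongation of a vector field `V = τ ∂_t + ξ ∂_x + η ∂_u` -/

/-- The coefficient `τ` of `∂_t`. -/
def coeffT (V : Base → Base) (p : Base) : ℝ := (V p).1

/-- The coefficient `ξ` of `∂_x`. -/
def coeffX (V : Base → Base) (p : Base) : ℝ := (V p).2.1

/-- The coefficient `η` of `∂_u`. -/
def coeffU (V : Base → Base) (p : Base) : ℝ := (V p).2.2

/-- `η^t = D_t η - u_t D_t τ - u_x D_t ξ`. -/
def prolongT (V : Base → Base) (j : Jet1) : ℝ :=
  totalDt (coeffU V) j - Jet1.ut j * totalDt (coeffT V) j - Jet1.ux j * totalDt (coeffX V) j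

/-- `η^x = D_x η - u_t D_x τ - u_x D_x ξ`. -/
def prolongX (V : Base → Base) (j : Jet1) : ℝ :=
  totalDx (coeffU V) j - Jet1.ut j * totalDx (coeffT V) j - Jet1.ux j * totalDx (coeffX V) j

/-- `η^{tt} = D_t η^t - u_tt D_t τ - u_tx D_t ξ`. -/
def prolongTT (V : Base → Base) (j : Jet2) : ℝ :=
  totalDt₁ (prolongT V) j - Jet2.utt j * totalDt (coeffT V) j.1
    - Jet2.utx j * totalDt (coeffX V) j.1

/-- `η^{tx} = D_x η^t - u_tt D_x τ - u_tx D_x ξ`. -/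
def prolongTX (V : Base → Base) (j : Jet2) : ℝ :=
  totalDx₁ (prolongT V) j - Jet2.utt j * totalDx (coeffT V) j.1
    - Jet2.utx j * totalDx (coeffX V) j.1

/-- `η^{xx} = D_x η^x - u_tx D_x τ - u_xx D_x ξ`. -/
def prolongXX (V : Base → Base) (j : Jet2) : ℝ :=
  totalDx₁ (prolongX V) j - Jet2.utx j * totalDx (coeffT V) j.1
    - Jet2.uxx j * totalDx (coeffX V) j.1

/-- The second prolongation
`τ ∂_t + ξ ∂_x + η ∂_u + η^t ∂_{u_t} + η^x ∂_{u_x} + η^{tt} ∂_{u_tt} + η^{tx} ∂_{u_tx}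
+ η^{xx} ∂_{u_xx}`, a vector field on the second jet space. -/
def prolong2 (V : Base → Base) (j : Jet2) : Jet2 :=
  ((V j.1.1, (prolongT V j.1, prolongX V j.1)), (prolongTT V j, prolongTX V j, prolongXX V j))

/-- `V` generates Lie point symmetries over `U` of the second-order equation `Δ = 0`: its second
prolongation annihilates `Δ` at every point of the hypersurface `Δ = 0` of the second jet space
that lies over `U`. -/
def IsLieSymmetry (Δ : Jet2 → ℝ) (U : Set Base) (V : Base → Base) : Prop :=
  ∀ j : Jet2, j.1.1 ∈ U → Δ j = 0 → fderiv ℝ Δ j (prolong2 V j) = 0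

/-- The left-hand side of the equation `u_t + (u_x + u_xx) ^ 2 = 0`. -/
def equationLHS (j : Jet2) : ℝ :=
  Jet1.ut j.1 + (Jet1.ux j.1 + Jet2.uxx j) ^ 2

/-! ### The Lie algebra of smooth vector fields on an open set -/

/-- The smooth vector fields on an open set `U`. So that a vector field on `U` is exactly one
element, it is stored as a function on the whole space that vanishes off `U`; its values off `U`
have no other meaning. -/
def smoothFields (U : TopologicalSpace.Opens Base) : Submodule ℝ (Base → Base) where
  carrier := {V | ContDiffOn ℝ ∞ V U ∧ ∀ p ∉ U, V p = 0}
  add_mem' := fun hV hW => ⟨hV.1.add hW.1, fun p hp => by simp [hV.2 p hp, hW.2 p hp]⟩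
  zero_mem' := ⟨contDiffOn_const, fun _ _ => rfl⟩
  smul_mem' := fun c _ hV => ⟨contDiffOn_const.smul hV.1, fun p hp => by simp [hV.2 p hp]⟩

/-- The type of smooth vector fields on `U`. -/
abbrev SmoothField (U : TopologicalSpace.Opens Base) : Type := smoothFields U

variable {U : TopologicalSpace.Opens Base}

theorem SmoothField.contDiffAt (V : SmoothField U) {p : Base} (hp : p ∈ U) :
    ContDiffAt ℝ ∞ (V : Base → Base) p :=
  V.2.1.contDiffAt (U.isOpen.mem_nhds hp)

theorem SmoothField.differentiableAt (V : SmoothField U) {p : Base} (hp : p ∈ U) :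
    DifferentiableAt ℝ (V : Base → Base) p :=
  (V.contDiffAt hp).differentiableAt (by simp)

theorem SmoothField.ext_on {V W : SmoothField U}
    (h : ∀ p ∈ U, (V : Base → Base) p = (W : Base → Base) p) : V = W := by
  apply Subtype.ext
  funext p
  by_cases hp : p ∈ U
  · exact h p hp
  · rw [V.2.2 p hp, W.2.2 p hp]

/-- The restriction to `U` of a vector field that is smooth on the whole space. -/
def restrictField (U : TopologicalSpace.Opens Base) (V : Base → Base) (hV : ContDiff ℝ ∞ V) :
    SmoothField U :=
  ⟨(U : Set Base).indicator V,
    hV.contDiffOn.congr fun _ hp => Set.indicator_of_mem hp V,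
    fun _ hp => Set.indicator_of_notMem hp V⟩

/-- The commutator of vector fields on `U`: the usual Lie bracket, `[V, W] = V(W) - W(V)` in
coefficients, at the points of `U`. -/
instance : Bracket (SmoothField U) (SmoothField U) where
  bracket V W := ⟨(U : Set Base).indicator (VectorField.lieBracket ℝ V W),
    ContDiffOn.congr
      (fun _ hp => ((V.contDiffAt hp).lieBracket_vectorField (W.contDiffAt hp)
        (m := ∞) (by simp)).contDiffWithinAt)
      fun _ hp => Set.indicator_of_mem hp _,
    fun _ hp => Set.indicator_of_notMem hp _⟩

theorem SmoothField.bracket_apply (V W : SmoothField U) {p : Base} (hp : p ∈ U) :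
    ((⁅V, W⁆ : SmoothField U) : Base → Base) p = VectorField.lieBracket ℝ V W p :=
  Set.indicator_of_mem (s := (U : Set Base)) hp _

theorem SmoothField.bracket_eventuallyEq (V W : SmoothField U) {p : Base} (hp : p ∈ U) :
    ((⁅V, W⁆ : SmoothField U) : Base → Base) =ᶠ[nhds p] VectorField.lieBracket ℝ V W :=
  Filter.eventually_of_mem (U.isOpen.mem_nhds hp) fun _ hq => V.bracket_apply W hq

instance : LieRing (SmoothField U) where
  add_lie V W Z := SmoothField.ext_on fun p hp => by
    have h := VectorField.lieBracket_add_left (W := (Z : Base → Base))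
      (V.differentiableAt hp) (W.differentiableAt hp)
    simpa [SmoothField.bracket_apply _ _ hp] using h
  lie_add V W Z := SmoothField.ext_on fun p hp => by
    have h := VectorField.lieBracket_add_right (V := (V : Base → Base))
      (W.differentiableAt hp) (Z.differentiableAt hp)
    simpa [SmoothField.bracket_apply _ _ hp] using h
  lie_self V := SmoothField.ext_on fun p hp => by
    simp [SmoothField.bracket_apply _ _ hp]
  leibniz_lie V W Z := SmoothField.ext_on fun p hp => by
    have h := VectorField.leibniz_identity_lieBracket (𝕜 := ℝ) (n := ∞)
      (by simpa using (ENat.LEInfty.out : (2 : WithTop ℕ∞) ≤ ∞))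
      (V.contDiffAt hp) (W.contDiffAt hp) (Z.contDiffAt hp)
    have e (A B C : SmoothField U) :
        VectorField.lieBracket ℝ A (⁅B, C⁆ : SmoothField U) p
          = VectorField.lieBracket ℝ A (VectorField.lieBracket ℝ B C) p :=
      Filter.EventuallyEq.lieBracket_vectorField_eq Filter.EventuallyEq.rfl
        (B.bracket_eventuallyEq C hp)
    have e' (A B C : SmoothField U) :
        VectorField.lieBracket ℝ (⁅A, B⁆ : SmoothField U) C p
          = VectorField.lieBracket ℝ (VectorField.lieBracket ℝ A B) C p :=
      Filter.EventuallyEq.lieBracket_vectorField_eq (A.bracket_eventuallyEq B hp)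
        Filter.EventuallyEq.rfl
    rw [Submodule.coe_add, Pi.add_apply]
    simp only [SmoothField.bracket_apply _ _ hp, e, e']
    exact h

instance : LieAlgebra ℝ (SmoothField U) where
  lie_smul c V W := SmoothField.ext_on fun p hp => by
    have h := VectorField.lieBracket_const_smul_right (V := (V : Base → Base)) (c := c)
      (W.differentiableAt hp)
    simpa [SmoothField.bracket_apply _ _ hp] using h

/-! ### The five generators -/

/-- `X₁ = -∂_x`. -/
def X1 (U : TopologicalSpace.Opens Base) : SmoothField U :=
  restrictField U (fun _ => (0, -1, 0)) contDiff_const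

/-- `X₂ = -e^{-x} ∂_u`. -/
def X2 (U : TopologicalSpace.Opens Base) : SmoothField U :=
  restrictField U (fun p => (0, 0, -Real.exp (-p.2.1))) (by fun_prop)

/-- `X₃ = ∂_t`. -/
def X3 (U : TopologicalSpace.Opens Base) : SmoothField U :=
  restrictField U (fun _ => (1, 0, 0)) contDiff_const

/-- `X₄ = ∂_u`. -/
def X4 (U : TopologicalSpace.Opens Base) : SmoothField U :=
  restrictField U (fun _ => (0, 0, 1)) contDiff_const

/-- `X₅ = t ∂_t - u ∂_u`. -/
def X5 (U : TopologicalSpace.Opens Base) : SmoothField U :=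
  restrictField U (fun p => (p.1, 0, -p.2.2)) (by fun_prop)

/-! ### The Lie algebras `A₁` and `A₂` -/

/-- The one-dimensional Lie algebra: `ℝ` with the zero bracket. -/
def A1 : Type := ℝ

namespace A1

instance : AddCommGroup A1 := inferInstanceAs (AddCommGroup ℝ)

instance : Module ℝ A1 := inferInstanceAs (Module ℝ ℝ)

instance : LieRing A1 where
  bracket _ _ := 0
  add_lie _ _ _ := (add_zero 0).symm
  lie_add _ _ _ := (add_zero 0).symm
  lie_self _ := rfl
  leibniz_lie _ _ _ := (add_zero 0).symm

instance : LieAlgebra ℝ A1 where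
  lie_smul r _ _ := (smul_zero r).symm

end A1

/-- The non-abelian two-dimensional Lie algebra, with basis `e₁, e₂` and `[e₁, e₂] = e₂`. -/
@[ext] structure A2 : Type where
  /-- the coefficient of `e₁` -/
  c1 : ℝ
  /-- the coefficient of `e₂` -/
  c2 : ℝ

namespace A2

/-- `a₁ e₁ + a₂ e₂` as the pair `(a₁, a₂)`. -/
def toProd : A2 ≃ ℝ × ℝ where
  toFun a := (a.c1, a.c2)
  invFun a := ⟨a.1, a.2⟩
  left_inv _ := rfl
  right_inv _ := rfl

instance : AddCommGroup A2 := toProd.addCommGroup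

instance : Module ℝ A2 := toProd.module ℝ

instance : Bracket A2 A2 where
  bracket a b := ⟨0, a.c1 * b.c2 - a.c2 * b.c1⟩

theorem zero_eq : (0 : A2) = ⟨0, 0⟩ := rfl

theorem add_eq (a b : A2) : a + b = ⟨a.c1 + b.c1, a.c2 + b.c2⟩ := rfl

theorem smul_eq (r : ℝ) (a : A2) : r • a = ⟨r * a.c1, r * a.c2⟩ := rfl

theorem lie_eq (a b : A2) : ⁅a, b⁆ = ⟨0, a.c1 * b.c2 - a.c2 * b.c1⟩ := rfl

instance : LieRing A2 where
  add_lie a b c := by simp only [lie_eq, add_eq, A2.mk.injEq]; constructor <;> first | trivial | ring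
  lie_add a b c := by simp only [lie_eq, add_eq, A2.mk.injEq]; constructor <;> first | trivial | ring
  lie_self a := by simp only [lie_eq, zero_eq, A2.mk.injEq]; constructor <;> first | trivial | ring
  leibniz_lie a b c := by simp only [lie_eq, add_eq, A2.mk.injEq]; constructor <;> first | trivial | ring

instance : LieAlgebra ℝ A2 where
  lie_smul r a b := by simp only [lie_eq, smul_eq, A2.mk.injEq]; constructor <;> first | trivial | ring

end A2

/-- The Lie algebra `A` is the (internal) semidirect sum of its subalgebra `L` and its ideal `I`:
the sum map is an isomorphism of a semidirect sum of `I` and `L` onto `A`. -/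
def IsSemidirectSum {A : Type*} [LieRing A] [LieAlgebra ℝ A]
    (L : LieSubalgebra ℝ A) (I : LieIdeal ℝ A) : Prop :=
  ∃ (ψ : L →ₗ⁅ℝ⁆ LieDerivation ℝ I I)
    (e : LieAlgebra.SemiDirectSum I L ψ ≃ₗ⁅ℝ⁆ A),
    ∀ (i : I) (l : L), e ⟨i, l⟩ = (i : A) + (l : A)

end PointSymmetry

end

namespace PointSymmetry

/-! The hypersurface `Δ = 0` is the graph `u_t = -s²` with `s = u_x + u_xx`. Writing `q = u_x` and
`w = u_tx`, the restriction of `pr⁽²⁾V(Δ)` to it is a polynomial in the free variables `q, s, w`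
whose coefficients are built from derivatives of `τ, ξ, η`. So `V` is a symmetry exactly when this
polynomial, `determiningFn`, vanishes identically over every point of `U` (`isLieSymmetry_iff`).

The variable `w` enters only through `-4 s w (τ_x + q τ_u)`, hence `τ_x = τ_u = 0`. The remaining
monomials give `η_t = ξ_t = ξ_u = 0`, `η_u = 4 ξ_x - τ_t`, `η_xx = -η_x` and `ξ_x + 2 η_xu = ξ_xx`.
Differentiating the relation for `η_u` gives `τ_tt = 0` and `η_xu = 4 ξ_xx`. Then `ξ_x + 7 ξ_xx =
0`, while `η_xxu = -η_xu` forces `ξ_xxx = -ξ_xx`; the two decay rates disagree, so `ξ_x = 0`. What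
is left integrates to five constants (`exists_coefficients`), and the converse is a substitution
(`determiningFn_eq_zero`).

The commutators are direct computations. The Lie-algebraic conclusions use only the structure
constants `bracketCoords`: no bracket has an `X₅` component, and among `X₁, …, X₄` only `[X₁, X₂] =
X₂` is non-zero. -/

/-! ### Directional derivatives of smooth functions on an open set -/

/-- The derivative of `f` in the constant direction `v`. -/
noncomputable def dirDeriv (v : Base) (f : Base → ℝ) (p : Base) : ℝ := fderiv ℝ f p v

/-- The direction `∂_t`. -/
abbrev dirT : Base := (1, 0, 0)

/-- The direction `∂_x`. -/
abbrev dirX : Base := (0, 1, 0)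

/-- The direction `∂_u`. -/
abbrev dirU : Base := (0, 0, 1)

section

variable {U : TopologicalSpace.Opens Base} {f g : Base → ℝ} {p : Base}

theorem differentiableAt_of_smooth (hf : ContDiffOn ℝ ∞ f U) (hp : p ∈ U) :
    DifferentiableAt ℝ f p :=
  (hf.contDiffAt (U.isOpen.mem_nhds hp)).differentiableAt (by simp)

theorem contDiffOn_dirDeriv (hf : ContDiffOn ℝ ∞ f U) (v : Base) :
    ContDiffOn ℝ ∞ (dirDeriv v f) U :=
  (hf.fderiv_of_isOpen U.isOpen (by simp)).clm_apply contDiffOn_const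

theorem dirDeriv_comm (hf : ContDiffOn ℝ ∞ f U) (hp : p ∈ U) (v w : Base) :
    dirDeriv v (dirDeriv w f) p = dirDeriv w (dirDeriv v f) p := by
  have hs : IsSymmSndFDerivAt ℝ f p := by
    refine (hf.contDiffAt (U.isOpen.mem_nhds hp)).isSymmSndFDerivAt ?_
    simpa using (ENat.LEInfty.out : (2 : WithTop ℕ∞) ≤ ∞)
  have hd : DifferentiableAt ℝ (fderiv ℝ f) p :=
    ((hf.fderiv_of_isOpen (m := ∞) U.isOpen (by simp)).contDiffAt
      (U.isOpen.mem_nhds hp)).differentiableAt (by simp)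
  have key (v w : Base) : dirDeriv v (dirDeriv w f) p = fderiv ℝ (fderiv ℝ f) p v w := by
    have : dirDeriv w f = fun q => fderiv ℝ f q w := rfl
    rw [dirDeriv, this, fderiv_clm_apply hd (differentiableAt_const w)]
    simp
  rw [key, key, hs.eq]

theorem dirDeriv_congr (h : Set.EqOn f g U) (v : Base) :
    Set.EqOn (dirDeriv v f) (dirDeriv v g) U := fun p hp => by
  rw [dirDeriv, dirDeriv, (h.eventuallyEq_of_mem (U.isOpen.mem_nhds hp)).fderiv_eq]

theorem dirDeriv_of_eqOn_const {c : ℝ} (h : ∀ q ∈ U, f q = c) (v : Base) (hp : p ∈ U) :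
    dirDeriv v f p = 0 := by
  rw [dirDeriv_congr (g := fun _ => c) h v hp]
  simp [dirDeriv]

theorem fderiv_eq_dirDeriv (f : Base → ℝ) (p : Base) (a b c : ℝ) :
    fderiv ℝ f p (a, b, c) = a * dirDeriv dirT f p + b * dirDeriv dirX f p
      + c * dirDeriv dirU f p := by
  have : ((a, b, c) : Base) = a • dirT + b • dirX + c • dirU := by simp [dirT, dirX, dirU]
  rw [this, map_add, map_add, map_smul, map_smul, map_smul]
  rfl

/-- The only integration principle used. Since `U` is merely connected, `τ_x = τ_u = 0` need not
make `τ` a function of `t` alone globally; every integration is therefore arranged as a function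
with zero gradient. -/
theorem exists_eq_const_of_dirDeriv (hU : IsPreconnected (U : Set Base))
    (hf : ContDiffOn ℝ ∞ f U) (ht : ∀ q ∈ U, dirDeriv dirT f q = 0)
    (hx : ∀ q ∈ U, dirDeriv dirX f q = 0) (hu : ∀ q ∈ U, dirDeriv dirU f q = 0) :
    ∃ c, ∀ q ∈ U, f q = c := by
  refine U.isOpen.exists_is_const_of_fderiv_eq_zero hU
    (hf.differentiableOn (by simp)) fun q hq => ?_
  refine ContinuousLinearMap.ext fun v => ?_
  simp [fderiv_eq_dirDeriv f q v.1 v.2.1 v.2.2, ht q hq, hx q hq, hu q hq]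

/-! ### Functions of the form `c₀ + c₁ t + c₂ u + c₃ e^{-x}` -/

/-- The function `c₀ + c₁ t + c₂ u + c₃ e^{-x}`. -/
noncomputable def affineExp (c₀ c₁ c₂ c₃ : ℝ) (p : Base) : ℝ :=
  c₀ + c₁ * p.1 + c₂ * p.2.2 + c₃ * Real.exp (-p.2.1)

theorem hasFDerivAt_affineExp (c₀ c₁ c₂ c₃ : ℝ) (p : Base) :
    ∃ D : Base →L[ℝ] ℝ, HasFDerivAt (affineExp c₀ c₁ c₂ c₃) D p ∧
      ∀ v, D v = c₁ * v.1 + c₂ * v.2.2 - c₃ * Real.exp (-p.2.1) * v.2.1 := by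
  have h1 : HasFDerivAt (fun p : Base => p.1) (ContinuousLinearMap.fst ℝ ℝ (ℝ × ℝ)) p :=
    hasFDerivAt_fst
  have h2 : HasFDerivAt (fun p : Base => p.2) (ContinuousLinearMap.snd ℝ ℝ (ℝ × ℝ)) p :=
    hasFDerivAt_snd
  refine ⟨_, (((hasFDerivAt_const c₀ p).add (h1.const_mul c₁)).add (h2.snd.const_mul c₂)).add
    (h2.fst.neg.exp.const_mul c₃), fun v => ?_⟩
  simp
  ring

/-- The family is stable under constant directional derivatives, so derivatives of any order are
found by rewriting. Constants are included as `affineExp c 0 0 0`. -/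
theorem dirDeriv_affineExp (c₀ c₁ c₂ c₃ : ℝ) (v : Base) :
    dirDeriv v (affineExp c₀ c₁ c₂ c₃)
      = affineExp (c₁ * v.1 + c₂ * v.2.2) 0 0 (-c₃ * v.2.1) := by
  funext p
  obtain ⟨D, hD, h⟩ := hasFDerivAt_affineExp c₀ c₁ c₂ c₃ p
  rw [dirDeriv, hD.fderiv, h, affineExp]
  ring

theorem contDiff_affineExp (c₀ c₁ c₂ c₃ : ℝ) : ContDiff ℝ ∞ (affineExp c₀ c₁ c₂ c₃) := by
  unfold affineExp
  fun_prop

theorem dirDeriv_add (hf : ContDiffOn ℝ ∞ f U) (hg : ContDiffOn ℝ ∞ g U) (hp : p ∈ U)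
    (v : Base) : dirDeriv v (fun q => f q + g q) p = dirDeriv v f p + dirDeriv v g p := by
  rw [dirDeriv, fderiv_fun_add (differentiableAt_of_smooth hf hp) (differentiableAt_of_smooth hg hp)]
  rfl

theorem dirDeriv_mul (hf : ContDiffOn ℝ ∞ f U) (hg : ContDiffOn ℝ ∞ g U) (hp : p ∈ U)
    (v : Base) : dirDeriv v (fun q => f q * g q) p = f p * dirDeriv v g p + g p * dirDeriv v f p := by
  rw [dirDeriv, fderiv_fun_mul (differentiableAt_of_smooth hf hp) (differentiableAt_of_smooth hg hp)]
  rfl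

/-! ### Prolongation in terms of directional derivatives -/

theorem totalDt_eq (f : Base → ℝ) (j : Jet1) :
    totalDt f j = dirDeriv dirT f j.1 + Jet1.ut j * dirDeriv dirU f j.1 := by
  rw [totalDt, fderiv_eq_dirDeriv]
  ring

theorem totalDx_eq (f : Base → ℝ) (j : Jet1) :
    totalDx f j = dirDeriv dirX f j.1 + Jet1.ux j * dirDeriv dirU f j.1 := by
  rw [totalDx, fderiv_eq_dirDeriv]
  ring

theorem hasFDerivAt_ut (j : Jet1) : HasFDerivAt Jet1.ut
    ((ContinuousLinearMap.fst ℝ ℝ ℝ).comp (ContinuousLinearMap.snd ℝ Base (ℝ × ℝ))) j :=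
  ContinuousLinearMap.hasFDerivAt
    ((ContinuousLinearMap.fst ℝ ℝ ℝ).comp (ContinuousLinearMap.snd ℝ Base (ℝ × ℝ)))

theorem hasFDerivAt_ux (j : Jet1) : HasFDerivAt Jet1.ux
    ((ContinuousLinearMap.snd ℝ ℝ ℝ).comp (ContinuousLinearMap.snd ℝ Base (ℝ × ℝ))) j :=
  ContinuousLinearMap.hasFDerivAt
    ((ContinuousLinearMap.snd ℝ ℝ ℝ).comp (ContinuousLinearMap.snd ℝ Base (ℝ × ℝ)))

theorem hasFDerivAt_comp_base (hf : ContDiffOn ℝ ∞ f U) {j : Jet1} (hj : j.1 ∈ U) :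
    HasFDerivAt (fun i : Jet1 => f i.1)
      ((fderiv ℝ f j.1).comp (ContinuousLinearMap.fst ℝ Base (ℝ × ℝ))) j :=
  (differentiableAt_of_smooth hf hj).hasFDerivAt.comp j hasFDerivAt_fst

/-- The recorded direction is the one defining `totalDx₁`, so the value is `D_x² f`. The entry `w`
has no effect because `D_x f` does not involve `u_t`. -/
theorem hasFDerivAt_totalDx (hf : ContDiffOn ℝ ∞ f U) {j : Jet1} (hj : j.1 ∈ U) :
    ∃ D : Jet1 →L[ℝ] ℝ, HasFDerivAt (totalDx f) D j ∧ ∀ m w : ℝ,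
      D ((0, 1, Jet1.ux j), (w, m)) = dirDeriv dirX (dirDeriv dirX f) j.1
        + 2 * Jet1.ux j * dirDeriv dirX (dirDeriv dirU f) j.1
        + Jet1.ux j ^ 2 * dirDeriv dirU (dirDeriv dirU f) j.1 + m * dirDeriv dirU f j.1 := by
  have he : totalDx f = fun i => dirDeriv dirX f i.1 + Jet1.ux i * dirDeriv dirU f i.1 :=
    funext (totalDx_eq f)
  rw [he]
  refine ⟨_, (hasFDerivAt_comp_base (contDiffOn_dirDeriv hf dirX) hj).add
    ((hasFDerivAt_ux j).mul (hasFDerivAt_comp_base (contDiffOn_dirDeriv hf dirU) hj)),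
    fun m w => ?_⟩
  simp [fderiv_eq_dirDeriv, dirDeriv_comm hf hj dirU dirX]
  ring

/-- The value `D_x² f = f_xx + 2 u_x f_xu + u_x² f_uu + u_xx f_u` at `u_x = q`, `u_xx = m`. -/
noncomputable def totalDxx (f : Base → ℝ) (p : Base) (q m : ℝ) : ℝ :=
  dirDeriv dirX (dirDeriv dirX f) p + 2 * q * dirDeriv dirX (dirDeriv dirU f) p
    + q ^ 2 * dirDeriv dirU (dirDeriv dirU f) p + m * dirDeriv dirU f p

variable {V : Base → Base}

/-- Leibniz rule for `D_x`. Each factor `2` combines one term from differentiating the products in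
`η^x` with one from the definition of `η^{xx}`. -/
theorem prolongXX_eq (hT : ContDiffOn ℝ ∞ (coeffT V) U) (hX : ContDiffOn ℝ ∞ (coeffX V) U)
    (hη : ContDiffOn ℝ ∞ (coeffU V) U) {j : Jet2} (hj : j.1.1 ∈ U) :
    prolongXX V j = totalDxx (coeffU V) j.1.1 (Jet1.ux j.1) (Jet2.uxx j)
      - 2 * Jet2.utx j * totalDx (coeffT V) j.1
      - Jet1.ut j.1 * totalDxx (coeffT V) j.1.1 (Jet1.ux j.1) (Jet2.uxx j)
      - 2 * Jet2.uxx j * totalDx (coeffX V) j.1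
      - Jet1.ux j.1 * totalDxx (coeffX V) j.1.1 (Jet1.ux j.1) (Jet2.uxx j) := by
  obtain ⟨A, hA, hA'⟩ := hasFDerivAt_totalDx hT hj
  obtain ⟨B, hB, hB'⟩ := hasFDerivAt_totalDx hX hj
  obtain ⟨C, hC, hC'⟩ := hasFDerivAt_totalDx hη hj
  have h := (hC.sub ((hasFDerivAt_ut j.1).mul hA)).sub ((hasFDerivAt_ux j.1).mul hB)
  have he : prolongX V = totalDx (coeffU V) - Jet1.ut * totalDx (coeffT V)
      - Jet1.ux * totalDx (coeffX V) := rfl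
  rw [prolongXX, totalDx₁, he, h.fderiv]
  simp [hA', hB', hC', totalDxx]
  ring

theorem fderiv_equationLHS (j W : Jet2) : fderiv ℝ equationLHS j W
    = W.1.2.1 + 2 * (Jet1.ux j.1 + Jet2.uxx j) * (W.1.2.2 + W.2.2.2) := by
  have h1 : HasFDerivAt (fun i : Jet2 => i.1) (ContinuousLinearMap.fst ℝ Jet1 (ℝ × ℝ × ℝ)) j :=
    hasFDerivAt_fst
  have h2 : HasFDerivAt (fun i : Jet2 => i.2) (ContinuousLinearMap.snd ℝ Jet1 (ℝ × ℝ × ℝ)) j :=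
    hasFDerivAt_snd
  have h : HasFDerivAt equationLHS _ j := h1.snd.fst.add ((h1.snd.snd.add h2.snd.snd).pow 2)
  rw [h.fderiv]
  simp [Jet1.ux, Jet2.uxx]
  ring

/-- The value of `pr⁽²⁾V(Δ)` over `p` where `u_x = q`, `u_xx = s - q`, `u_t = -s²`, `u_tx = w`. -/
noncomputable def determiningFn (V : Base → Base) (p : Base) (q s w : ℝ) : ℝ :=
  (dirDeriv dirT (coeffU V) p - s ^ 2 * dirDeriv dirU (coeffU V) p
      + s ^ 2 * (dirDeriv dirT (coeffT V) p - s ^ 2 * dirDeriv dirU (coeffT V) p)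
      - q * (dirDeriv dirT (coeffX V) p - s ^ 2 * dirDeriv dirU (coeffX V) p))
    + 2 * s * ((dirDeriv dirX (coeffU V) p + q * dirDeriv dirU (coeffU V) p
      + (s ^ 2 - 2 * w) * (dirDeriv dirX (coeffT V) p + q * dirDeriv dirU (coeffT V) p)
      - (2 * s - q) * (dirDeriv dirX (coeffX V) p + q * dirDeriv dirU (coeffX V) p))
      + (totalDxx (coeffU V) p q (s - q) + s ^ 2 * totalDxx (coeffT V) p q (s - q)
        - q * totalDxx (coeffX V) p q (s - q)))

/-- The hypersurface is parametrized by `p, u_x, u_xx, u_tx, u_tt`. As `Δ` involves neither `u_tt`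
nor `u_tx`, only `η^t, η^x, η^{xx}` contribute, and `u_tt` disappears. -/
theorem isLieSymmetry_iff (hT : ContDiffOn ℝ ∞ (coeffT V) U) (hX : ContDiffOn ℝ ∞ (coeffX V) U)
    (hη : ContDiffOn ℝ ∞ (coeffU V) U) :
    IsLieSymmetry equationLHS U V ↔ ∀ p ∈ U, ∀ q s w, determiningFn V p q s w = 0 := by
  have key (p : Base) (hp : p ∈ U) (q m w z : ℝ) :
      fderiv ℝ equationLHS ((p, (-(q + m) ^ 2, q)), (z, w, m))
        (prolong2 V ((p, (-(q + m) ^ 2, q)), (z, w, m))) = determiningFn V p q (q + m) w := by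
    rw [fderiv_equationLHS, prolong2, prolongXX_eq hT hX hη hp, prolongT, prolongX]
    simp only [totalDt_eq, totalDx_eq, Jet1.ut, Jet1.ux, Jet2.uxx, Jet2.utx, determiningFn,
      add_sub_cancel_left]
    ring
  constructor
  · intro h p hp q s w
    have := h ((p, (-(q + (s - q)) ^ 2, q)), (0, w, s - q)) hp
      (by simp [equationLHS, Jet1.ut, Jet1.ux, Jet2.uxx])
    rw [key p hp] at this
    simpa using this
  · rintro h ⟨⟨p, r, q⟩, z, w, m⟩ hp hj
    have hr : r = -(q + m) ^ 2 := by
      simp only [equationLHS, Jet1.ut, Jet1.ux, Jet2.uxx] at hj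
      linarith
    subst hr
    rw [key p hp]
    exact h p hp _ _ _

end

section

variable {U : TopologicalSpace.Opens Base} {V : Base → Base}

/-! ### The determining equations and their solutions -/

/-- Coefficients of `u_tx` in the determining equation. -/
theorem dirDeriv_coeffT_eq_zero {p : Base} (h : ∀ q s w, determiningFn V p q s w = 0) :
    dirDeriv dirX (coeffT V) p = 0 ∧ dirDeriv dirU (coeffT V) p = 0 := by
  -- At `s = 1` the slope in `w` is `-4 (τ_x + q τ_u)`; differences in `w` at `q = 0` and `q = 1`
  -- isolate both derivatives.
  have h1 := h 0 1 0
  have h2 := h 0 1 1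
  have h3 := h 1 1 0
  have h4 := h 1 1 1
  simp only [determiningFn] at h1 h2 h3 h4
  constructor <;> linarith

/-- Coefficients of the monomials in `u_x` and `u_x + u_xx` in the determining equation, once `τ`
depends on `t` only. -/
theorem determining_equations {p : Base} (h : ∀ q s w, determiningFn V p q s w = 0)
    (hx : dirDeriv dirX (coeffT V) p = 0) (hu : dirDeriv dirU (coeffT V) p = 0)
    (hxx : dirDeriv dirX (dirDeriv dirX (coeffT V)) p = 0)
    (hxu : dirDeriv dirX (dirDeriv dirU (coeffT V)) p = 0)
    (huu : dirDeriv dirU (dirDeriv dirU (coeffT V)) p = 0) :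
    dirDeriv dirT (coeffU V) p = 0 ∧ dirDeriv dirT (coeffX V) p = 0 ∧
    dirDeriv dirU (coeffX V) p = 0 ∧
    dirDeriv dirU (coeffU V) p = 4 * dirDeriv dirX (coeffX V) p - dirDeriv dirT (coeffT V) p ∧
    dirDeriv dirX (dirDeriv dirX (coeffU V)) p = -dirDeriv dirX (coeffU V) p ∧
    dirDeriv dirX (coeffX V) p + 2 * dirDeriv dirX (dirDeriv dirU (coeffU V)) p
      - dirDeriv dirX (dirDeriv dirX (coeffX V)) p = 0 := by
  have e (q s : ℝ) := h q s 0
  simp only [determiningFn, totalDxx, hx, hu, hxx, hxu, huu] at e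
  -- The values `s = ±1` separate the odd and even parts in `s`. The part linear in `s` is cubic in
  -- `q`, so `q = ±2` is needed to split off its `q³` term, whose coefficient involves `ξ_uu`.
  have a1 := e 0 0
  have a2 := e 1 0
  have b1 := e 0 1
  have b2 := e 0 (-1)
  have c1 := e 1 1
  have c2 := e 1 (-1)
  have d1 := e (-1) 1
  have d2 := e (-1) (-1)
  have f1 := e 2 1
  have f2 := e 2 (-1)
  have g1 := e (-2) 1
  have g2 := e (-2) (-1)
  have hη : dirDeriv dirT (coeffU V) p = 0 := by linarith
  have hξ : dirDeriv dirT (coeffX V) p = 0 := by linarith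
  refine ⟨hη, hξ, ?_, ?_, ?_, ?_⟩ <;> linarith

theorem exists_coefficients (hU : IsPreconnected (U : Set Base))
    (hT : ContDiffOn ℝ ∞ (coeffT V) U) (hX : ContDiffOn ℝ ∞ (coeffX V) U)
    (hη : ContDiffOn ℝ ∞ (coeffU V) U)
    (h : ∀ p ∈ U, ∀ q s w, determiningFn V p q s w = 0) :
    ∃ a₁ a₂ a₃ a₄ a₅ : ℝ, ∀ p ∈ U,
      coeffT V p = affineExp a₃ a₅ 0 0 p ∧ coeffX V p = -a₁ ∧
      coeffU V p = affineExp a₄ 0 (-a₅) (-a₂) p := by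
  have hTx : ∀ p ∈ U, dirDeriv dirX (coeffT V) p = 0 := fun p hp =>
    (dirDeriv_coeffT_eq_zero (h p hp)).1
  have hTu : ∀ p ∈ U, dirDeriv dirU (coeffT V) p = 0 := fun p hp =>
    (dirDeriv_coeffT_eq_zero (h p hp)).2
  have D := fun p (hp : p ∈ U) => determining_equations (h p hp) (hTx p hp) (hTu p hp)
    (dirDeriv_of_eqOn_const hTx _ hp) (dirDeriv_of_eqOn_const hTu _ hp)
    (dirDeriv_of_eqOn_const hTu _ hp)
  have hηt : ∀ p ∈ U, dirDeriv dirT (coeffU V) p = 0 := fun p hp => (D p hp).1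
  have hXt : ∀ p ∈ U, dirDeriv dirT (coeffX V) p = 0 := fun p hp => (D p hp).2.1
  have hXu : ∀ p ∈ U, dirDeriv dirU (coeffX V) p = 0 := fun p hp => (D p hp).2.2.1
  -- `η_u + τ_t = 4 ξ_x`, and its consequences `τ_tt = 0`, `η_uu = 0`, `η_xu = 4 ξ_xx`
  have hsum : ∀ p ∈ U, dirDeriv dirU (coeffU V) p + dirDeriv dirT (coeffT V) p
      + affineExp (-4) 0 0 0 p * dirDeriv dirX (coeffX V) p = 0 := fun p hp => by
    have := (D p hp).2.2.2.1
    simp only [affineExp]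
    linarith
  have hc (c : ℝ) : ContDiffOn ℝ ∞ (affineExp c 0 0 0) U := (contDiff_affineExp _ _ _ _).contDiffOn
  have hηu := contDiffOn_dirDeriv hη dirU
  have hTt := contDiffOn_dirDeriv hT dirT
  have hXx := contDiffOn_dirDeriv hX dirX
  have hdiff (v : Base) (p : Base) (hp : p ∈ U) : dirDeriv v (dirDeriv dirU (coeffU V)) p
      + dirDeriv v (dirDeriv dirT (coeffT V)) p
      - 4 * dirDeriv v (dirDeriv dirX (coeffX V)) p = 0 := by
    have := dirDeriv_of_eqOn_const hsum v hp
    rw [dirDeriv_add (hηu.add hTt) ((hc _).mul hXx) hp, dirDeriv_add hηu hTt hp,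
      dirDeriv_mul (hc _) hXx hp, dirDeriv_affineExp] at this
    simp only [affineExp] at this
    linarith
  -- In the direction `t`, the terms `η_ut` and `ξ_xt` vanish by symmetry of second derivatives.
  have hTtt : ∀ p ∈ U, dirDeriv dirT (dirDeriv dirT (coeffT V)) p = 0 := fun p hp => by
    have h1 := hdiff dirT p hp
    rw [dirDeriv_comm hη hp, dirDeriv_comm hX hp, dirDeriv_of_eqOn_const hηt _ hp,
      dirDeriv_of_eqOn_const hXt _ hp] at h1
    linarith
  have hηxu : ∀ p ∈ U, dirDeriv dirX (dirDeriv dirU (coeffU V)) p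
      = 4 * dirDeriv dirX (dirDeriv dirX (coeffX V)) p := fun p hp => by
    have h1 := hdiff dirX p hp
    rw [dirDeriv_comm hT hp, dirDeriv_of_eqOn_const hTx _ hp] at h1
    linarith
  -- `ξ_x + 7 ξ_xx = 0` and `ξ_xx + ξ_xxx = 0`, so `ξ_x = 0`
  have hXxx : Set.EqOn (dirDeriv dirX (dirDeriv dirX (coeffX V)))
      (fun p => affineExp (-1 / 7) 0 0 0 p * dirDeriv dirX (coeffX V) p) U := fun p hp => by
    have h1 := (D p hp).2.2.2.2.2
    rw [hηxu p hp] at h1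
    simp only [affineExp]
    linarith
  have hXxxx : ∀ p ∈ U, dirDeriv dirX (dirDeriv dirX (dirDeriv dirX (coeffX V))) p
      = -1 / 7 * dirDeriv dirX (dirDeriv dirX (coeffX V)) p := fun p hp => by
    rw [dirDeriv_congr hXxx dirX hp, dirDeriv_mul (hc _) hXx hp, dirDeriv_affineExp]
    simp [affineExp]
  have hηxxu : ∀ p ∈ U, dirDeriv dirX (dirDeriv dirX (dirDeriv dirU (coeffU V))) p
      = -dirDeriv dirX (dirDeriv dirU (coeffU V)) p := fun p hp => by
    have h0 : ∀ q ∈ U, dirDeriv dirX (dirDeriv dirX (coeffU V)) q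
        + dirDeriv dirX (coeffU V) q = 0 := fun q hq => by
      simp [(D q hq).2.2.2.2.1]
    have hηx := contDiffOn_dirDeriv hη dirX
    have h1 := dirDeriv_of_eqOn_const h0 dirU hp
    rw [dirDeriv_add (contDiffOn_dirDeriv hηx _) hηx hp, dirDeriv_comm hηx hp,
      dirDeriv_congr (fun q hq => dirDeriv_comm hη hq dirU dirX) dirX hp,
      dirDeriv_comm hη hp] at h1
    linarith
  -- With `η_xu = 4 ξ_xx` and `ξ_xxx = -ξ_xx / 7`, the relation `η_xxu = -η_xu` becomes `-(4/7) ξ_xx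
  -- = -4 ξ_xx`.
  have hXx0 : ∀ p ∈ U, dirDeriv dirX (coeffX V) p = 0 := fun p hp => by
    have h1 := hηxxu p hp
    have hηxu' : Set.EqOn (dirDeriv dirX (dirDeriv dirU (coeffU V)))
        (fun q => affineExp 4 0 0 0 q * dirDeriv dirX (dirDeriv dirX (coeffX V)) q) U := fun q hq => by
      simp [hηxu q hq, affineExp]
    rw [dirDeriv_congr hηxu' dirX hp, dirDeriv_mul (hc _) (contDiffOn_dirDeriv hXx _) hp,
      dirDeriv_affineExp, hηxu p hp, hXxxx p hp, hXxx hp] at h1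
    simp only [affineExp] at h1
    linarith
  -- integration
  obtain ⟨c, hcX⟩ := exists_eq_const_of_dirDeriv hU hX hXt hXx0 hXu
  obtain ⟨a₅, h₅⟩ := exists_eq_const_of_dirDeriv hU hTt hTtt
    (fun p hp => by rw [dirDeriv_comm hT hp, dirDeriv_of_eqOn_const hTx _ hp])
    (fun p hp => by rw [dirDeriv_comm hT hp, dirDeriv_of_eqOn_const hTu _ hp])
  have hs (c₀ c₁ c₂ c₃ : ℝ) : ContDiffOn ℝ ∞ (affineExp c₀ c₁ c₂ c₃) U :=
    (contDiff_affineExp _ _ _ _).contDiffOn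
  obtain ⟨a₃, h₃⟩ := exists_eq_const_of_dirDeriv hU (hT.add (hs 0 (-a₅) 0 0))
    (fun p hp => by
      rw [dirDeriv_add hT (hs _ _ _ _) hp, dirDeriv_affineExp, h₅ p hp]; simp [affineExp])
    (fun p hp => by
      rw [dirDeriv_add hT (hs _ _ _ _) hp, dirDeriv_affineExp, hTx p hp]; simp [affineExp])
    (fun p hp => by
      rw [dirDeriv_add hT (hs _ _ _ _) hp, dirDeriv_affineExp, hTu p hp]; simp [affineExp])
  have hηu' : ∀ p ∈ U, dirDeriv dirU (coeffU V) p = -a₅ := fun p hp => by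
    rw [(D p hp).2.2.2.1, hXx0 p hp, h₅ p hp]
    ring
  have hηx := contDiffOn_dirDeriv hη dirX
  have hexp : ContDiffOn ℝ ∞ (fun p : Base => Real.exp p.2.1) U :=
    (by fun_prop : ContDiff ℝ ∞ (fun p : Base => Real.exp p.2.1)).contDiffOn
  have hdexp (v p : Base) : dirDeriv v (fun p : Base => Real.exp p.2.1) p
      = Real.exp p.2.1 * v.2.1 := by
    have h2 : HasFDerivAt (fun p : Base => p.2) (ContinuousLinearMap.snd ℝ ℝ (ℝ × ℝ)) p :=
      hasFDerivAt_snd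
    rw [dirDeriv, h2.fst.exp.fderiv]
    simp
  -- `e^x` is an integrating factor: `(e^x η_x)_x = e^x (η_x + η_xx) = 0`.
  obtain ⟨a₂, h₂⟩ := exists_eq_const_of_dirDeriv hU (hexp.mul hηx)
    (fun p hp => by
      have := dirDeriv_mul hexp hηx hp dirT
      rw [hdexp, dirDeriv_comm hη hp, dirDeriv_of_eqOn_const hηt _ hp] at this
      refine this.trans ?_
      simp)
    (fun p hp => by
      have := dirDeriv_mul hexp hηx hp dirX
      rw [hdexp, (D p hp).2.2.2.2.1] at this
      refine this.trans ?_
      ring)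
    (fun p hp => by
      have := dirDeriv_mul hexp hηx hp dirU
      rw [hdexp, dirDeriv_comm hη hp, dirDeriv_of_eqOn_const hηu' _ hp] at this
      refine this.trans ?_
      simp)
  have hηx' : ∀ p ∈ U, dirDeriv dirX (coeffU V) p = a₂ * Real.exp (-p.2.1) := fun p hp => by
    rw [← h₂ p hp, mul_right_comm, ← Real.exp_add]
    simp
  obtain ⟨a₄, h₄⟩ := exists_eq_const_of_dirDeriv hU (hη.add (hs 0 0 a₅ a₂))
    (fun p hp => by
      rw [dirDeriv_add hη (hs _ _ _ _) hp, dirDeriv_affineExp, hηt p hp]; simp [affineExp])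
    (fun p hp => by
      rw [dirDeriv_add hη (hs _ _ _ _) hp, dirDeriv_affineExp, hηx' p hp]; simp [affineExp])
    (fun p hp => by
      rw [dirDeriv_add hη (hs _ _ _ _) hp, dirDeriv_affineExp, hηu' p hp]; simp [affineExp])
  -- The sign of `c` is reversed because `X₁ = -∂_x`.
  refine ⟨-c, a₂, a₃, a₄, a₅, fun p hp => ⟨?_, ?_, ?_⟩⟩
  · have := h₃ p hp
    simp only [affineExp] at this ⊢
    linarith
  · rw [hcX p hp, neg_neg]
  · have := h₄ p hp
    simp only [affineExp] at this ⊢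
    linarith

/-- Agreement on the open set `U` passes to all derivatives, after which the identity reduces to
`η_x + η_xx = 0` and `η_u + τ_t = 0`. -/
theorem determiningFn_eq_zero {a₁ a₂ a₃ a₄ a₅ : ℝ}
    (hT : Set.EqOn (coeffT V) (affineExp a₃ a₅ 0 0) U)
    (hX : Set.EqOn (coeffX V) (affineExp (-a₁) 0 0 0) U)
    (hη : Set.EqOn (coeffU V) (affineExp a₄ 0 (-a₅) (-a₂)) U)
    {p : Base} (hp : p ∈ U) (q s w : ℝ) : determiningFn V p q s w = 0 := by
  have h1 (v : Base) := dirDeriv_congr hT v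
  have h2 (v : Base) := dirDeriv_congr hX v
  have h3 (v : Base) := dirDeriv_congr hη v
  have k1 (v w : Base) := dirDeriv_congr (h1 v) w hp
  have k2 (v w : Base) := dirDeriv_congr (h2 v) w hp
  have k3 (v w : Base) := dirDeriv_congr (h3 v) w hp
  simp only [determiningFn, totalDxx, k1, k2, k3, h1 _ hp, h2 _ hp, h3 _ hp, dirDeriv_affineExp]
  simp [affineExp]
  ring

end

/-! ### The commutators of the generators -/

section

variable (U : TopologicalSpace.Opens Base)

theorem restrictField_apply {V : Base → Base} (hV : ContDiff ℝ ∞ V) {p : Base} (hp : p ∈ U) :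
    (restrictField U V hV : Base → Base) p = V p :=
  Set.indicator_of_mem (s := (U : Set Base)) hp V

/-- Near a point of `U` the restriction has the same germ as the global field, so the bracket can be
computed from the global formulas. -/
theorem lie_restrictField {V W : Base → Base} (hV : ContDiff ℝ ∞ V) (hW : ContDiff ℝ ∞ W)
    {p : Base} (hp : p ∈ U) :
    ((⁅restrictField U V hV, restrictField U W hW⁆ : SmoothField U) : Base → Base) p
      = fderiv ℝ W p (V p) - fderiv ℝ V p (W p) := by
  have h {Z : Base → Base} (hZ : ContDiff ℝ ∞ Z) :
      (restrictField U Z hZ : Base → Base) =ᶠ[nhds p] Z :=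
    Filter.eventually_of_mem (U.isOpen.mem_nhds hp) fun _ hq => restrictField_apply U hZ hq
  rw [SmoothField.bracket_apply _ _ hp, (h hV).lieBracket_vectorField_eq (h hW)]
  rfl

theorem fderiv_const_field (c p v : Base) : fderiv ℝ (fun _ : Base => c) p v = 0 := by
  simp

theorem fderiv_expField (p v : Base) :
    fderiv ℝ (fun p : Base => ((0, 0, -Real.exp (-p.2.1)) : Base)) p v
      = (0, 0, Real.exp (-p.2.1) * v.2.1) := by
  have h2 : HasFDerivAt (fun p : Base => p.2) (ContinuousLinearMap.snd ℝ ℝ (ℝ × ℝ)) p :=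
    hasFDerivAt_snd
  have h : HasFDerivAt (fun p : Base => ((0, 0, -Real.exp (-p.2.1)) : Base)) _ p :=
    (hasFDerivAt_const (0 : ℝ) p).prodMk
      ((hasFDerivAt_const (0 : ℝ) p).prodMk h2.fst.neg.exp.neg)
  rw [h.fderiv]
  simp

theorem fderiv_scalingField (p v : Base) :
    fderiv ℝ (fun p : Base => ((p.1, 0, -p.2.2) : Base)) p v = (v.1, 0, -v.2.2) := by
  have h1 : HasFDerivAt (fun p : Base => p.1) (ContinuousLinearMap.fst ℝ ℝ (ℝ × ℝ)) p :=
    hasFDerivAt_fst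
  have h2 : HasFDerivAt (fun p : Base => p.2) (ContinuousLinearMap.snd ℝ ℝ (ℝ × ℝ)) p :=
    hasFDerivAt_snd
  have h : HasFDerivAt (fun p : Base => ((p.1, 0, -p.2.2) : Base)) _ p :=
    h1.prodMk ((hasFDerivAt_const (0 : ℝ) p).prodMk h2.snd.neg)
  rw [h.fderiv]
  simp

theorem lie_X1_X2 : ⁅X1 U, X2 U⁆ = X2 U := SmoothField.ext_on fun p hp => by
  rw [X1, X2, lie_restrictField _ _ _ hp, fderiv_expField, fderiv_const_field,
    restrictField_apply _ _ hp]
  simp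

theorem lie_X2_X5 : ⁅X2 U, X5 U⁆ = -X2 U := SmoothField.ext_on fun p hp => by
  rw [X2, X5, lie_restrictField _ _ _ hp, fderiv_expField, fderiv_scalingField,
    Submodule.coe_neg, Pi.neg_apply, restrictField_apply _ _ hp]
  simp

theorem lie_X3_X5 : ⁅X3 U, X5 U⁆ = X3 U := SmoothField.ext_on fun p hp => by
  rw [X3, X5, lie_restrictField _ _ _ hp, fderiv_scalingField, fderiv_const_field,
    restrictField_apply _ _ hp]
  simp

theorem lie_X4_X5 : ⁅X4 U, X5 U⁆ = -X4 U := SmoothField.ext_on fun p hp => by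
  rw [X4, X5, lie_restrictField _ _ _ hp, fderiv_scalingField, fderiv_const_field,
    Submodule.coe_neg, Pi.neg_apply, restrictField_apply _ _ hp]
  simp

theorem lie_X1_X3 : ⁅X1 U, X3 U⁆ = 0 := SmoothField.ext_on fun p hp => by
  rw [X1, X3, lie_restrictField _ _ _ hp, fderiv_const_field, fderiv_const_field]
  simp

theorem lie_X1_X4 : ⁅X1 U, X4 U⁆ = 0 := SmoothField.ext_on fun p hp => by
  rw [X1, X4, lie_restrictField _ _ _ hp, fderiv_const_field, fderiv_const_field]
  simp

theorem lie_X1_X5 : ⁅X1 U, X5 U⁆ = 0 := SmoothField.ext_on fun p hp => by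
  rw [X1, X5, lie_restrictField _ _ _ hp, fderiv_scalingField, fderiv_const_field]
  simp

theorem lie_X2_X3 : ⁅X2 U, X3 U⁆ = 0 := SmoothField.ext_on fun p hp => by
  rw [X2, X3, lie_restrictField _ _ _ hp, fderiv_expField, fderiv_const_field]
  simp

theorem lie_X2_X4 : ⁅X2 U, X4 U⁆ = 0 := SmoothField.ext_on fun p hp => by
  rw [X2, X4, lie_restrictField _ _ _ hp, fderiv_expField, fderiv_const_field]
  simp

theorem lie_X3_X4 : ⁅X3 U, X4 U⁆ = 0 := SmoothField.ext_on fun p hp => by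
  rw [X3, X4, lie_restrictField _ _ _ hp, fderiv_const_field, fderiv_const_field]
  simp

/-! ### The span of the generators -/

/-- The linear combination `∑ aᵢ Xᵢ` of the generators. -/
noncomputable def combination : (Fin 5 → ℝ) →ₗ[ℝ] SmoothField U :=
  Fintype.linearCombination ℝ ![X1 U, X2 U, X3 U, X4 U, X5 U]

theorem combination_eq (a : Fin 5 → ℝ) : combination U a
    = a 0 • X1 U + a 1 • X2 U + a 2 • X3 U + a 3 • X4 U + a 4 • X5 U := by
  simp [combination, Fintype.linearCombination_apply, Fin.sum_univ_five]

theorem combination_apply (a : Fin 5 → ℝ) {p : Base} (hp : p ∈ U) :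
    (combination U a : Base → Base) p = (affineExp (a 2) (a 4) 0 0 p, -a 0,
      affineExp (a 3) 0 (-a 4) (-a 1) p) := by
  rw [combination_eq]
  simp only [Submodule.coe_add, Submodule.coe_smul, Pi.add_apply, Pi.smul_apply, X1, X2, X3, X4,
    X5, restrictField_apply U _ hp]
  simp [affineExp, mul_comm]
  ring

/-- The coordinates of the commutator of two combinations of the generators. -/
def bracketCoords (a c : Fin 5 → ℝ) : Fin 5 → ℝ :=
  ![0, a 0 * c 1 - a 1 * c 0 - (a 1 * c 4 - a 4 * c 1), a 2 * c 4 - a 4 * c 2,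
    -(a 3 * c 4 - a 4 * c 3), 0]

/-- Gives at once the closure of the span under the bracket and its structure constants. -/
theorem lie_combination (a c : Fin 5 → ℝ) :
    ⁅combination U a, combination U c⁆ = combination U (bracketCoords a c) := by
  have s {V W Z : SmoothField U} (h : ⁅V, W⁆ = Z) : ⁅W, V⁆ = -Z := by rw [← h, lie_skew]
  simp only [combination_eq, add_lie, lie_add, smul_lie, lie_smul, lie_self, lie_X1_X2, lie_X2_X5,
    lie_X3_X5, lie_X4_X5, lie_X1_X3, lie_X1_X4, lie_X1_X5, lie_X2_X3, lie_X2_X4, lie_X3_X4,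
    s (lie_X1_X2 U), s (lie_X2_X5 U), s (lie_X3_X5 U), s (lie_X4_X5 U), s (lie_X1_X3 U),
    s (lie_X1_X4 U), s (lie_X1_X5 U), s (lie_X2_X3 U), s (lie_X2_X4 U), s (lie_X3_X4 U)]
  simp only [bracketCoords, Matrix.cons_val]
  module

variable {U} in
theorem combination_injective (hU : (U : Set Base).Nonempty) :
    Function.Injective (combination U) := by
  rw [← LinearMap.ker_eq_bot, LinearMap.ker_eq_bot']
  intro a ha
  obtain ⟨p, hp⟩ := hU
  have h : ∀ q ∈ U, affineExp (a 2) (a 4) 0 0 q = 0 ∧ a 0 = 0 ∧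
      affineExp (a 3) 0 (-a 4) (-a 1) q = 0 := fun q hq => by
    have := combination_apply U a hq
    rw [ha] at this
    simpa [Prod.ext_iff, eq_comm] using this
  -- At a single point, `τ_t` detects the coefficient of `X₅` and `η_x` that of `X₂`; the values of
  -- `τ, ξ, η` then give the rest.
  have h4 := dirDeriv_of_eqOn_const (fun q hq => (h q hq).1) dirT hp
  have h1 := dirDeriv_of_eqOn_const (fun q hq => (h q hq).2.2) dirX hp
  rw [dirDeriv_affineExp] at h4 h1
  obtain ⟨h2, h0, h3⟩ := h p hp
  simp [affineExp] at h4 h1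
  simp [affineExp, h4, h1] at h2 h3
  ext i
  fin_cases i <;> simp [h0, h1, h2, h3, h4]

variable {U} in
theorem isLieSymmetry_iff_mem_range (hU : IsPreconnected (U : Set Base)) (V : SmoothField U) :
    IsLieSymmetry equationLHS U V ↔ V ∈ LinearMap.range (combination U) := by
  have hT : ContDiffOn ℝ ∞ (coeffT V) U := V.2.1.fst
  have hX : ContDiffOn ℝ ∞ (coeffX V) U := V.2.1.snd.fst
  have hη : ContDiffOn ℝ ∞ (coeffU V) U := V.2.1.snd.snd
  rw [isLieSymmetry_iff hT hX hη]
  constructor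
  · intro h
    obtain ⟨a₁, a₂, a₃, a₄, a₅, H⟩ := exists_coefficients hU hT hX hη h
    refine ⟨![a₁, a₂, a₃, a₄, a₅], SmoothField.ext_on fun p hp => ?_⟩
    obtain ⟨h1, h2, h3⟩ := H p hp
    rw [combination_apply U _ hp]
    exact (Prod.ext h1 (Prod.ext h2 h3)).symm
  · rintro ⟨a, rfl⟩ p hp q s w
    refine determiningFn_eq_zero (a₁ := a 0) (a₂ := a 1) (a₃ := a 2) (a₄ := a 3) (a₅ := a 4)
      (fun p hp => ?_) (fun p hp => ?_) (fun p hp => ?_) hp q s w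
    · rw [coeffT, combination_apply U a hp]
    · rw [coeffX, combination_apply U a hp]
      simp [affineExp]
    · rw [coeffU, combination_apply U a hp]

end

/-! ### Internal semidirect sums -/

section

variable {A : Type*} [LieRing A] [LieAlgebra ℝ A]

/-- The adjoint action of a subalgebra on an ideal, by derivations. -/
def adOnIdeal (L : LieSubalgebra ℝ A) (I : LieIdeal ℝ A) : L →ₗ⁅ℝ⁆ LieDerivation ℝ I I where
  toFun l :=
    { toFun := fun i => ⁅(l : A), i⁆
      map_add' := fun _ _ => lie_add _ _ _
      map_smul' := fun _ _ => lie_smul _ _ _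
      leibniz' := fun a b => Subtype.ext <| by
        change ⁅(l : A), ⁅(a : A), (b : A)⁆⁆ = ⁅(a : A), ⁅(l : A), (b : A)⁆⁆
          - ⁅(b : A), ⁅(l : A), (a : A)⁆⁆
        rw [leibniz_lie, ← lie_skew (b : A), sub_neg_eq_add, add_comm] }
  map_add' l m := LieDerivation.ext fun i => add_lie (l : A) (m : A) i
  map_smul' c l := LieDerivation.ext fun i => smul_lie c (l : A) i
  map_lie' {l m} := LieDerivation.ext fun i => Subtype.ext (lie_lie (l : A) (m : A) (i : A))

/-- Complementarity makes `(i, l) ↦ i + l` a linear isomorphism. It respects brackets because `[i +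
l, i' + l'] = [i, i'] + [l, i'] - [l', i] + [l, l']`, the semidirect bracket for the adjoint action.
-/
theorem isSemidirectSum_of_isCompl (L : LieSubalgebra ℝ A) (I : LieIdeal ℝ A)
    (h : IsCompl I.toSubmodule L.toSubmodule) : IsSemidirectSum L I := by
  let e : (I × L) ≃ₗ[ℝ] A := Submodule.prodEquivOfIsCompl I.toSubmodule L.toSubmodule h
  refine ⟨adOnIdeal L I,
    { (LieAlgebra.SemiDirectSum.toProdl (adOnIdeal L I)).trans e with
      map_lie' := fun {x y} => ?_ }, fun i l => ?_⟩
  · change ((⁅x.left, y.left⁆ + ⁅(x.right : A), y.left⁆ - ⁅(y.right : A), x.left⁆ : I) : A)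
        + ⁅(x.right : A), (y.right : A)⁆
      = ⁅(x.left : A) + (x.right : A), (y.left : A) + (y.right : A)⁆
    change ⁅(x.left : A), (y.left : A)⁆ + ⁅(x.right : A), (y.left : A)⁆
      - ⁅(y.right : A), (x.left : A)⁆ + ⁅(x.right : A), (y.right : A)⁆ = _
    rw [add_lie, lie_add, lie_add, ← lie_skew (y.right : A) (x.left : A)]
    abel
  · rfl

end

/-! ### Lie algebras with the structure constants of the generators -/

section

variable {A : Type*} [LieRing A] [LieAlgebra ℝ A] (e : A ≃ₗ[ℝ] (Fin 5 → ℝ))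
  (he : ∀ x y, e ⁅x, y⁆ = bracketCoords (e x) (e y))

/-- The ideal of the elements whose fifth coordinate vanishes. -/
def coordIdeal : LieIdeal ℝ A :=
  { LinearMap.ker (LinearMap.proj 4 ∘ₗ e.toLinearMap) with
    lie_mem := fun {x m} _ => by
      -- The last entry of `bracketCoords` is zero, so every bracket lies in this subspace.
      change e ⁅x, m⁆ 4 = 0
      rw [he]
      rfl }

theorem mem_coordIdeal {x : A} : x ∈ coordIdeal e he ↔ e x 4 = 0 := Iff.rfl

/-- The subalgebra of the elements whose first four coordinates vanish. -/
def coordSubalgebra : LieSubalgebra ℝ A where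
  carrier := {x | e x 0 = 0 ∧ e x 1 = 0 ∧ e x 2 = 0 ∧ e x 3 = 0}
  zero_mem' := by simp
  add_mem' := by
    rintro x y ⟨h0, h1, h2, h3⟩ ⟨k0, k1, k2, k3⟩
    simp [h0, h1, h2, h3, k0, k1, k2, k3]
  smul_mem' := by
    rintro c x ⟨h0, h1, h2, h3⟩
    simp [h0, h1, h2, h3]
  lie_mem' := by
    rintro x y ⟨h0, h1, h2, h3⟩ ⟨k0, k1, k2, k3⟩
    simp only [Set.mem_ofPred_eq] at h0 h1 h2 h3 k0 k1 k2 k3 ⊢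
    simp [he, bracketCoords, h0, h1, h2, h3, k0, k1, k2, k3]

theorem eq_sum_basis (x : A) : x = e x 0 • Module.Basis.ofEquivFun e 0
    + e x 1 • Module.Basis.ofEquivFun e 1 + e x 2 • Module.Basis.ofEquivFun e 2
    + e x 3 • Module.Basis.ofEquivFun e 3 + e x 4 • Module.Basis.ofEquivFun e 4 := by
  have := (Module.Basis.ofEquivFun e).sum_equivFun x
  rw [Fin.sum_univ_five, Module.Basis.equivFun_ofEquivFun] at this
  exact this.symm

theorem coord_basis (i j : Fin 5) :
    e (Module.Basis.ofEquivFun e i) j = (Pi.single i 1 : Fin 5 → ℝ) j := by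
  rw [Module.Basis.coe_ofEquivFun, LinearEquiv.apply_symm_apply]

theorem coordSubalgebra_eq_span : (coordSubalgebra e he).toSubmodule
    = Submodule.span ℝ {Module.Basis.ofEquivFun e 4} := by
  apply le_antisymm
  · rintro x ⟨h0, h1, h2, h3⟩
    rw [Submodule.mem_span_singleton]
    refine ⟨e x 4, ?_⟩
    conv_rhs => rw [eq_sum_basis e x, h0, h1, h2, h3]
    simp
  · rw [Submodule.span_singleton_le_iff_mem]
    exact ⟨by simp, by simp, by simp, by simp⟩

theorem coordIdeal_eq_span : (coordIdeal e he).toSubmodule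
    = Submodule.span ℝ {Module.Basis.ofEquivFun e 0, Module.Basis.ofEquivFun e 1,
      Module.Basis.ofEquivFun e 2, Module.Basis.ofEquivFun e 3} := by
  apply le_antisymm
  · intro x (hx : e x 4 = 0)
    rw [eq_sum_basis e x, hx, zero_smul, add_zero]
    refine add_mem (add_mem (add_mem ?_ ?_) ?_) ?_ <;>
      exact Submodule.smul_mem _ _ (Submodule.subset_span (by simp))
  · rw [Submodule.span_le]
    rintro x (rfl | rfl | rfl | rfl) <;>
      exact (coord_basis e _ _).trans (by simp)

theorem isCompl_coordIdeal_coordSubalgebra :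
    IsCompl (coordIdeal e he).toSubmodule (coordSubalgebra e he).toSubmodule := by
  constructor
  · rw [Submodule.disjoint_def]
    rintro x (h4 : e x 4 = 0) ⟨h0, h1, h2, h3⟩
    rw [eq_sum_basis e x, h0, h1, h2, h3, h4]
    simp
  · rw [Submodule.codisjoint_iff_exists_add_eq]
    refine fun x => ⟨x - e x 4 • Module.Basis.ofEquivFun e 4, e x 4 • Module.Basis.ofEquivFun e 4,
      ?_, ?_, sub_add_cancel _ _⟩
    · change e _ 4 = 0
      rw [map_sub, map_smul, Pi.sub_apply, Pi.smul_apply, coord_basis]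
      simp
    · rw [coordSubalgebra_eq_span]
      exact Submodule.smul_mem _ _ (Submodule.mem_span_singleton_self _)

/-- The ideal of the elements whose fifth coordinate vanishes is `A₂ ⊕ 2A₁`. -/
def coordIdealEquiv : coordIdeal e he ≃ₗ⁅ℝ⁆ A2 × A1 × A1 where
  toFun x := (⟨e x 0, e x 1⟩, e (x : A) 2, e (x : A) 3)
  map_add' x y := by
    change ((⟨e ((x : A) + y) 0, e ((x : A) + y) 1⟩, e ((x : A) + y) 2, e ((x : A) + y) 3) :
      A2 × ℝ × ℝ) = _
    rw [map_add]
    rfl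
  map_smul' c x := by
    change ((⟨e (c • (x : A)) 0, e (c • (x : A)) 1⟩, e (c • (x : A)) 2, e (c • (x : A)) 3) :
      A2 × ℝ × ℝ) = _
    rw [map_smul]
    rfl
  map_lie' {x y} := by
    change ((⟨e ⁅(x : A), (y : A)⁆ 0, e ⁅(x : A), (y : A)⁆ 1⟩, e ⁅(x : A), (y : A)⁆ 2,
      e ⁅(x : A), (y : A)⁆ 3) : A2 × ℝ × ℝ)
      = (⟨0, e (x : A) 0 * e (y : A) 1 - e (x : A) 1 * e (y : A) 0⟩, (0 : ℝ), (0 : ℝ))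
    have hx : e (x : A) 4 = 0 := x.2
    have hy : e (y : A) 4 = 0 := y.2
    -- Once the fifth coordinates vanish, only the contribution of `[X₁, X₂] = X₂` survives,
    -- matching `[e₁, e₂] = e₂`.
    rw [he]
    simp [bracketCoords, hx, hy]
  invFun z := ⟨e.symm ![z.1.c1, z.1.c2, z.2.1, z.2.2, 0], by simp [mem_coordIdeal]⟩
  left_inv x := by
    apply Subtype.ext
    apply e.injective
    have hx : e (x : A) 4 = 0 := x.2
    change e (e.symm ![e (x : A) 0, e (x : A) 1, e (x : A) 2, e (x : A) 3, 0]) = e x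
    rw [LinearEquiv.apply_symm_apply]
    ext i
    fin_cases i <;> simp [hx]
  right_inv z := by
    change ((⟨e (e.symm ![z.1.c1, z.1.c2, z.2.1, z.2.2, 0]) 0,
      e (e.symm ![z.1.c1, z.1.c2, z.2.1, z.2.2, 0]) 1⟩,
      e (e.symm ![z.1.c1, z.1.c2, z.2.1, z.2.2, 0]) 2,
      e (e.symm ![z.1.c1, z.1.c2, z.2.1, z.2.2, 0]) 3) : A2 × ℝ × ℝ) = z
    rw [LinearEquiv.apply_symm_apply]
    rfl

end

/-! ### The symmetry algebra and its coordinates -/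

/-- The span of the five generators, as a Lie algebra. -/
noncomputable def symmetryAlgebra (U : TopologicalSpace.Opens Base) :
    LieSubalgebra ℝ (SmoothField U) :=
  { LinearMap.range (combination U) with
    lie_mem' := by
      rintro _ _ ⟨a, rfl⟩ ⟨c, rfl⟩
      exact ⟨_, (lie_combination U a c).symm⟩ }

/-- The coordinates on the symmetry algebra. -/
noncomputable def symmetryCoords {U : TopologicalSpace.Opens Base}
    (hU : (U : Set Base).Nonempty) : symmetryAlgebra U ≃ₗ[ℝ] (Fin 5 → ℝ) :=
  (LinearEquiv.ofInjective (combination U) (combination_injective hU)).symm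

theorem combination_symmetryCoords {U : TopologicalSpace.Opens Base}
    (hU : (U : Set Base).Nonempty) (x : symmetryAlgebra U) :
    combination U (symmetryCoords hU x) = x :=
  congrArg Subtype.val
    ((LinearEquiv.ofInjective (combination U) (combination_injective hU)).apply_symm_apply x)

theorem symmetryCoords_lie {U : TopologicalSpace.Opens Base} (hU : (U : Set Base).Nonempty)
    (x y : symmetryAlgebra U) :
    symmetryCoords hU ⁅x, y⁆ = bracketCoords (symmetryCoords hU x) (symmetryCoords hU y) := by
  apply combination_injective hU
  rw [← lie_combination]
  simp only [combination_symmetryCoords]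
  rfl

theorem coe_symmetryBasis {U : TopologicalSpace.Opens Base} (hU : (U : Set Base).Nonempty)
    (i : Fin 5) : (Module.Basis.ofEquivFun (symmetryCoords hU) i : SmoothField U)
      = ![X1 U, X2 U, X3 U, X4 U, X5 U] i := by
  rw [← combination_symmetryCoords hU, Module.Basis.coe_ofEquivFun, LinearEquiv.apply_symm_apply,
    combination, Fintype.linearCombination_apply_single, one_smul]

end PointSymmetry

theorem mainTheorem3 (U : TopologicalSpace.Opens PointSymmetry.Base)
    (hU : IsConnected (U : Set PointSymmetry.Base)) :
    -- the infinitesimal point symmetries over `U` form a Lie algebra `A`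
    ∃ A : LieSubalgebra ℝ (PointSymmetry.SmoothField U),
      (∀ V : PointSymmetry.SmoothField U,
        V ∈ A ↔ PointSymmetry.IsLieSymmetry PointSymmetry.equationLHS U V) ∧
      -- it is five-dimensional, with basis `X₁, …, X₅`
      Module.finrank ℝ A = 5 ∧
      ∃ b : Module.Basis (Fin 5) ℝ A,
        (b 0 : PointSymmetry.SmoothField U) = PointSymmetry.X1 U ∧
        (b 1 : PointSymmetry.SmoothField U) = PointSymmetry.X2 U ∧
        (b 2 : PointSymmetry.SmoothField U) = PointSymmetry.X3 U ∧
        (b 3 : PointSymmetry.SmoothField U) = PointSymmetry.X4 U ∧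
        (b 4 : PointSymmetry.SmoothField U) = PointSymmetry.X5 U ∧
        -- the non-zero commutators
        ⁅PointSymmetry.X1 U, PointSymmetry.X2 U⁆ = PointSymmetry.X2 U ∧
        ⁅PointSymmetry.X2 U, PointSymmetry.X5 U⁆ = -PointSymmetry.X2 U ∧
        ⁅PointSymmetry.X3 U, PointSymmetry.X5 U⁆ = PointSymmetry.X3 U ∧
        ⁅PointSymmetry.X4 U, PointSymmetry.X5 U⁆ = -PointSymmetry.X4 U ∧
        -- the other commutators
        ⁅PointSymmetry.X1 U, PointSymmetry.X3 U⁆ = 0 ∧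
        ⁅PointSymmetry.X1 U, PointSymmetry.X4 U⁆ = 0 ∧
        ⁅PointSymmetry.X1 U, PointSymmetry.X5 U⁆ = 0 ∧
        ⁅PointSymmetry.X2 U, PointSymmetry.X3 U⁆ = 0 ∧
        ⁅PointSymmetry.X2 U, PointSymmetry.X4 U⁆ = 0 ∧
        ⁅PointSymmetry.X3 U, PointSymmetry.X4 U⁆ = 0 ∧
        -- `A` is the semidirect sum of `⟨X₅⟩` and the ideal `⟨X₁, X₂, X₃, X₄⟩ ≅ A₂ ⊕ 2A₁`
        ∃ (L : LieSubalgebra ℝ A) (I : LieIdeal ℝ A),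
          L.toSubmodule = Submodule.span ℝ {b 4} ∧
          I.toSubmodule = Submodule.span ℝ {b 0, b 1, b 2, b 3} ∧
          PointSymmetry.IsSemidirectSum L I ∧
          Nonempty (I ≃ₗ⁅ℝ⁆ PointSymmetry.A2 × PointSymmetry.A1 × PointSymmetry.A1) := by
  open PointSymmetry in
  have hne := hU.nonempty
  have he := symmetryCoords_lie hne
  refine ⟨symmetryAlgebra U, fun V => (isLieSymmetry_iff_mem_range hU.isPreconnected V).symm, ?_,
    Module.Basis.ofEquivFun (symmetryCoords hne), coe_symmetryBasis hne 0, coe_symmetryBasis hne 1,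
    coe_symmetryBasis hne 2, coe_symmetryBasis hne 3, coe_symmetryBasis hne 4, lie_X1_X2 U,
    lie_X2_X5 U, lie_X3_X5 U, lie_X4_X5 U, lie_X1_X3 U, lie_X1_X4 U, lie_X1_X5 U, lie_X2_X3 U,
    lie_X2_X4 U, lie_X3_X4 U, coordSubalgebra _ he, coordIdeal _ he, coordSubalgebra_eq_span _ he,
    coordIdeal_eq_span _ he,
    isSemidirectSum_of_isCompl _ _ (isCompl_coordIdeal_coordSubalgebra _ he), ⟨coordIdealEquiv _ he⟩⟩
  rw [(symmetryCoords hne).finrank_eq, Module.finrank_fin_fun]
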